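/- Let $\mathcal H$ be a complex Hilbert space, let $P\in\mathcal B(\mathcal H)$ be a nonzero positive operator (i.e. $\langle Px,x\rangle\ge 0$ for all $x$), and let $P^{1/2}$ be its positive square root. For a positive operator $Q$ on a complex Hilbert space $\mathcal K$ write $\langle x,y\rangle_Q=\langle Qx,y\rangle$ and $\|x\|_Q=\sqrt{\langle x,x\rangle_Q}$, let $\mathcal B_{Q}(\mathcal K)$ be the set of all $T\in\mathcal B(\mathcal K)$ for which there is $T_1\in\mathcal B(\mathcal K)$ with $\langle Tx,y\rangle_Q=\langle x,T_1y\rangle_Q$ for all $x,y\in\mathcal K$, and for $T\in\mathcal B_{Q^{1/2}}(\mathcal K)$ put $w_Q(T)=\sup\{|\langle Tx,x\rangle_Q| : x\in\mathcal K,\ \|x\|_Q=1\}$. For a complex matrix $C\in\mathcal M_n(\mathbb C)$ let $w(C)=\sup\{|\langle Cx,x\rangle| : x\in\mathbb C^n,\ \|x\|_2=1\}$ be its usual numerical radius. For $A=[a_{ij}]\in\mathcal M_n(\mathbb C)$ and $B\in\mathcal B(\mathcal H)$ let $A\otimes B=[a_{ij}B]_{i,j=1}^n$, a bounded operator on the Hilbert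 space direct sum $\mathcal H^n$ of $n$ copies of $\mathcal H$. Theorem. Let $n\ge 1$, $A=[a_{ij}]\in\mathcal M_n(\mathbb C)$ and $B\in\mathcal B_{P^{1/2}}(\mathcal H)$. Then $A\otimes B\in\mathcal B_{(I_n\otimes P)^{1/2}}(\mathcal H^n)$ and $\begin{bmatrix}0&a_{ij}\\ a_{ji}&0\end{bmatrix}\otimes B\in\mathcal B_{(I_2\otimes P)^{1/2}}(\mathcal H^2)$ for all $i\ne j$ (so that the numerical radii below are defined), and $$w_{I_n\otimes P}(A\otimes B)\le w(C),$$ where $C=[c_{ij}]\in\mathcal M_n(\mathbb C)$ has the entries $$c_{ii}=|a_{ii}|\,w_P(B),\qquad c_{ij}=w_{I_2\otimes P}\left(\begin{bmatrix}0&a_{ij}\\ a_{ji}&0\end{bmatrix}\otimes B\right)\quad (i\ne j).$$ -/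

import Mathlib

namespace SemiHilbert

noncomputable section

/-- The numerical radius `w(T) = sup {|⟨T x, x⟩| : ‖x‖ = 1}` of a bounded operator `T`. -/
def numericalRadius {H : Type*} [NormedAddCommGroup H] [InnerProductSpace ℂ H]
    (T : H →L[ℂ] H) : ℝ :=
  sSup {r : ℝ | ∃ x : H, ‖x‖ = 1 ∧ r = ‖inner ℂ x (T x)‖}

/-- The numerical radius of a complex `n × n` matrix, acting on the Euclidean space `ℂⁿ`. -/
def matrixNumericalRadius {n : ℕ} (C : Matrix (Fin n) (Fin n) ℂ) : ℝ :=
  numericalRadius (Matrix.toEuclideanCLM (𝕜 := ℂ) C)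

/-- The semi-inner product `⟨x, y⟩_P = ⟨P x, y⟩`, linear in `x` and conjugate-linear in `y`
(Mathlib's `inner` is conjugate-linear in its first argument, hence the swap). -/
def pInner {H : Type*} [NormedAddCommGroup H] [InnerProductSpace ℂ H]
    (P : H →L[ℂ] H) (x y : H) : ℂ :=
  inner ℂ y (P x)

/-- The seminorm `‖x‖_P = √⟨x, x⟩_P` (for positive `P`, the number `⟨x, x⟩_P` is real). -/
def pNorm {H : Type*} [NormedAddCommGroup H] [InnerProductSpace ℂ H]
    (P : H →L[ℂ] H) (x : H) : ℝ :=
  √(pInner P x x).re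

/-- `B₁` is a `P`-adjoint of `B`: `⟨B x, y⟩_P = ⟨x, B₁ y⟩_P` for all `x`, `y`. -/
def IsPAdjoint {H : Type*} [NormedAddCommGroup H] [InnerProductSpace ℂ H]
    (P B B₁ : H →L[ℂ] H) : Prop :=
  ∀ x y : H, pInner P (B x) y = pInner P x (B₁ y)

/-- `𝓑_P(H)`: the bounded operators on `H` that admit a (bounded) `P`-adjoint. -/
def adjointable {H : Type*} [NormedAddCommGroup H] [InnerProductSpace ℂ H]
    (P : H →L[ℂ] H) : Set (H →L[ℂ] H) :=
  {B | ∃ B₁ : H →L[ℂ] H, IsPAdjoint P B B₁}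

/-- `𝓑_{P^{1/2}}(H)`: the bounded operators that admit a `P^{1/2}`-adjoint, where `P^{1/2}`
is the positive square root of the positive operator `P`. -/
def sqrtAdjointable {H : Type*} [NormedAddCommGroup H] [InnerProductSpace ℂ H]
    [CompleteSpace H] (P : H →L[ℂ] H) : Set (H →L[ℂ] H) :=
  adjointable (CFC.sqrt P)

/-- The `P`-numerical radius `w_P(B) = sup {|⟨B x, x⟩_P| : ‖x‖_P = 1}`. -/
def pNumericalRadius {H : Type*} [NormedAddCommGroup H] [InnerProductSpace ℂ H]
    (P B : H →L[ℂ] H) : ℝ :=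
  sSup {r : ℝ | ∃ x : H, pNorm P x = 1 ∧ r = ‖pInner P (B x) x‖}

/-- The Hilbert space `Hⁿ = ℂⁿ ⊗ H`, the orthogonal direct sum of `n` copies of `H`. -/
abbrev HPow (n : ℕ) (H : Type*) : Type _ := PiLp 2 (fun _ : Fin n => H)

/-- The Kronecker product `A ⊗ B`, the operator matrix `[a_{ij} B]` acting on `Hⁿ`. -/
def kron {n : ℕ} {H : Type*} [NormedAddCommGroup H] [InnerProductSpace ℂ H]
    (A : Matrix (Fin n) (Fin n) ℂ) (B : H →L[ℂ] H) : HPow n H →L[ℂ] HPow n H :=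
  (PiLp.continuousLinearEquiv 2 ℂ (fun _ : Fin n => H)).symm.toContinuousLinearMap ∘L
    ContinuousLinearMap.pi fun i =>
      ∑ j, A i j • (B ∘L PiLp.proj 2 (fun _ : Fin n => H) j)

theorem kron_apply {n : ℕ} {H : Type*} [NormedAddCommGroup H] [InnerProductSpace ℂ H]
    (A : Matrix (Fin n) (Fin n) ℂ) (B : H →L[ℂ] H) (x : HPow n H) (i : Fin n) :
    kron A B x i = ∑ j, A i j • B (x j) := by
  simp [kron]

/-- The `2 × 2` anti-diagonal matrix with entries `a_{ij}` (upper right) and `a_{ji}`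
(lower left). -/
def antidiagBlock {n : ℕ} (A : Matrix (Fin n) (Fin n) ℂ) (i j : Fin n) :
    Matrix (Fin 2) (Fin 2) ℂ :=
  !![0, A i j; A j i, 0]

/-- The matrix `C` with diagonal entries `|a_{ii}| w_P(B)` and off-diagonal entries
`w_{I₂ ⊗ P}([0, a_{ij}; a_{ji}, 0] ⊗ B)`. -/
def comparisonMatrix {n : ℕ} {H : Type*} [NormedAddCommGroup H] [InnerProductSpace ℂ H]
    (P : H →L[ℂ] H) (A : Matrix (Fin n) (Fin n) ℂ) (B : H →L[ℂ] H) :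
    Matrix (Fin n) (Fin n) ℂ :=
  Matrix.of fun i j =>
    if i = j then ((‖A i i‖ * pNumericalRadius P B : ℝ) : ℂ)
    else ((pNumericalRadius (kron (1 : Matrix (Fin 2) (Fin 2) ℂ) P)
      (kron (antidiagBlock A i j) B) : ℝ) : ℂ)

end

end SemiHilbert

/-!
For `x = (x₁, …, xₙ)` the form of `A ⊗ B` splits over pairs of indices:
`⟨(A ⊗ B) x, x⟩ = ∑ᵢ aᵢᵢ ⟨B xᵢ, xᵢ⟩_P + ½ ∑_{i ≠ j} (aᵢⱼ ⟨B xⱼ, xᵢ⟩_P + aⱼᵢ ⟨B xᵢ, xⱼ⟩_P)`.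
A diagonal term is at most `cᵢᵢ ‖xᵢ‖_P²`. The bracket of an off-diagonal term is the form of the
`2 × 2` block `[0, aᵢⱼ; aⱼᵢ, 0] ⊗ B` at `(xᵢ, xⱼ)`, hence at most `cᵢⱼ (‖xᵢ‖_P² + ‖xⱼ‖_P²)`;
since the block is off-diagonal, replacing `xᵢ` by `s xᵢ` only multiplies the bracket by `s`, and
optimizing over `s` improves the bound to `2 cᵢⱼ ‖xᵢ‖_P ‖xⱼ‖_P` (`norm_antidiag_pInner_le`).
Altogether the form is at most `⟨C ξ, ξ⟩` for the unit vector `ξ = (‖x₁‖_P, …, ‖xₙ‖_P)`.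

The suprema are finite because a `P^{1/2}`-adjoint `B₁` of `B` satisfies `P^{1/2} B = B₁* P^{1/2}`,
which gives `|⟨B x, x⟩_P| ≤ ‖B₁‖ ‖x‖_P²` (`exists_norm_pInner_le`). The tensor products inherit
adjoints from `B` since `(I ⊗ P)^{1/2} = I ⊗ P^{1/2}` and `Aᴴ ⊗ B₁` is an adjoint of `A ⊗ B`.
-/

namespace SemiHilbert

/-! ### The semi-inner product of a positive operator -/

section Form

variable {H : Type*} [NormedAddCommGroup H] [InnerProductSpace ℂ H]

theorem pInner_smul_left (P : H →L[ℂ] H) (c : ℂ) (x y : H) :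
    pInner P (c • x) y = c * pInner P x y := by
  simp [pInner]

theorem pInner_smul_right (P : H →L[ℂ] H) (c : ℂ) (x y : H) :
    pInner P x (c • y) = starRingEnd ℂ c * pInner P x y := by
  simp [pInner, mul_comm]

theorem pInner_sum_left (P : H →L[ℂ] H) {ι : Type*} (s : Finset ι) (f : ι → H) (y : H) :
    pInner P (∑ i ∈ s, f i) y = ∑ i ∈ s, pInner P (f i) y := by
  simp [pInner]

theorem pInner_sum_right (P : H →L[ℂ] H) {ι : Type*} (s : Finset ι) (x : H) (f : ι → H) :
    pInner P x (∑ i ∈ s, f i) = ∑ i ∈ s, pInner P x (f i) := by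
  simp [pInner]

theorem pNorm_nonneg (P : H →L[ℂ] H) (x : H) : 0 ≤ pNorm P x := Real.sqrt_nonneg _

theorem pNorm_sq {P : H →L[ℂ] H} (hP : P.IsPositive) (x : H) :
    pNorm P x ^ 2 = (pInner P x x).re :=
  Real.sq_sqrt (hP.re_inner_nonneg_right x)

theorem pNorm_smul (P : H →L[ℂ] H) (c : ℂ) (x : H) : pNorm P (c • x) = ‖c‖ * pNorm P x := by
  have h : starRingEnd ℂ c * (c * pInner P x x) = ((‖c‖ ^ 2 : ℝ) : ℂ) * pInner P x x := by
    rw [← mul_assoc, ← Complex.normSq_eq_conj_mul_self, Complex.normSq_eq_norm_sq]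
  rw [pNorm, pInner_smul_right, pInner_smul_left, h, Complex.re_ofReal_mul,
    Real.sqrt_mul (by positivity), Real.sqrt_sq (norm_nonneg c), pNorm]

theorem pNumericalRadius_nonneg (P B : H →L[ℂ] H) : 0 ≤ pNumericalRadius P B :=
  Real.sSup_nonneg (by rintro _ ⟨x, -, rfl⟩; exact norm_nonneg _)

/-- A form bounded by a multiple of `‖·‖_P²` is bounded by `w_P(B) ‖·‖_P²`, also at the vectors
of `P`-seminorm zero, which the supremum defining `w_P(B)` does not see. -/
theorem norm_pInner_le {P B : H →L[ℂ] H}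
    (hB : ∃ K : ℝ, ∀ x, ‖pInner P (B x) x‖ ≤ K * pNorm P x ^ 2) (x : H) :
    ‖pInner P (B x) x‖ ≤ pNumericalRadius P B * pNorm P x ^ 2 := by
  obtain ⟨K, hK⟩ := hB
  rcases (pNorm_nonneg P x).eq_or_lt with h0 | hpos
  · simpa [← h0] using hK x
  · have hbdd : BddAbove {r : ℝ | ∃ x : H, pNorm P x = 1 ∧ r = ‖pInner P (B x) x‖} :=
      ⟨K, by rintro _ ⟨y, hy, rfl⟩; simpa [hy] using hK y⟩
    have h := le_csSup hbdd ⟨(((pNorm P x)⁻¹ : ℝ) : ℂ) • x, by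
      rw [pNorm_smul, Complex.norm_real, Real.norm_of_nonneg (by positivity),
        inv_mul_cancel₀ hpos.ne'], rfl⟩
    rw [map_smul, pInner_smul_left, pInner_smul_right, norm_mul, norm_mul, Complex.conj_ofReal,
      Complex.norm_real, Real.norm_of_nonneg (by positivity)] at h
    calc ‖pInner P (B x) x‖
        = ((pNorm P x)⁻¹ * ((pNorm P x)⁻¹ * ‖pInner P (B x) x‖)) * pNorm P x ^ 2 := by
          field_simp
      _ ≤ pNumericalRadius P B * pNorm P x ^ 2 := by gcongr; exact h

end Form

/-! ### Square roots and boundedness of adjointable operators -/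

section SquareRoot

variable {H : Type*} [NormedAddCommGroup H] [InnerProductSpace ℂ H] [CompleteSpace H]

theorem isPositive_sqrt (P : H →L[ℂ] H) : (CFC.sqrt P).IsPositive :=
  (ContinuousLinearMap.nonneg_iff_isPositive _).1 (CFC.sqrt_nonneg P)

theorem sqrt_sqrt_apply {P : H →L[ℂ] H} (hP : P.IsPositive) (x : H) :
    CFC.sqrt P (CFC.sqrt P x) = P x :=
  congrArg (fun T : H →L[ℂ] H => T x)
    (CFC.sqrt_mul_sqrt_self P ((ContinuousLinearMap.nonneg_iff_isPositive _).2 hP))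

theorem mem_sqrtAdjointable_of_isPAdjoint {Q R T T₁ : H →L[ℂ] H} (hR : R.IsPositive)
    (hRQ : ∀ x, R (R x) = Q x) (hT : IsPAdjoint R T T₁) : T ∈ sqrtAdjointable Q := by
  have h : CFC.sqrt Q = R :=
    CFC.sqrt_unique (ContinuousLinearMap.ext hRQ)
      ((ContinuousLinearMap.nonneg_iff_isPositive _).2 hR)
  rw [sqrtAdjointable, h]
  exact ⟨T₁, hT⟩

theorem pInner_eq_inner_sqrt {P : H →L[ℂ] H} (hP : P.IsPositive) (x y : H) :
    pInner P x y = inner ℂ (CFC.sqrt P y) (CFC.sqrt P x) := by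
  rw [(isPositive_sqrt P).inner_left_eq_inner_right, sqrt_sqrt_apply hP, pInner]

theorem pNorm_eq_norm_sqrt {P : H →L[ℂ] H} (hP : P.IsPositive) (x : H) :
    pNorm P x = ‖CFC.sqrt P x‖ := by
  rw [pNorm, pInner_eq_inner_sqrt hP, inner_self_eq_norm_sq_to_K]
  norm_cast
  exact Real.sqrt_sq (norm_nonneg _)

/-- Operators with a `P^{1/2}`-adjoint are bounded for the `P`-seminorm, so their
`P`-numerical radius is a supremum of a bounded set. -/
theorem exists_norm_pInner_le {P B : H →L[ℂ] H} (hP : P.IsPositive)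
    (hB : B ∈ sqrtAdjointable P) :
    ∃ K : ℝ, ∀ x, ‖pInner P (B x) x‖ ≤ K * pNorm P x ^ 2 := by
  obtain ⟨B₁, hB₁⟩ := hB
  refine ⟨‖ContinuousLinearMap.adjoint B₁‖, fun x => ?_⟩
  have h : CFC.sqrt P (B x) = ContinuousLinearMap.adjoint B₁ (CFC.sqrt P x) :=
    ext_inner_left ℂ fun y => by
      rw [ContinuousLinearMap.adjoint_inner_right]
      exact hB₁ x y
  rw [pInner_eq_inner_sqrt hP, pNorm_eq_norm_sqrt hP, h]
  calc _ ≤ ‖CFC.sqrt P x‖ * ‖ContinuousLinearMap.adjoint B₁ (CFC.sqrt P x)‖ :=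
        norm_inner_le_norm _ _
    _ ≤ ‖CFC.sqrt P x‖ * (‖ContinuousLinearMap.adjoint B₁‖ * ‖CFC.sqrt P x‖) := by
        gcongr; exact ContinuousLinearMap.le_opNorm _ _
    _ = _ := by ring

end SquareRoot

/-! ### Kronecker products on `Hⁿ` -/

section Kronecker

variable {H : Type*} [NormedAddCommGroup H] [InnerProductSpace ℂ H] {n : ℕ}

theorem kron_one_apply (P : H →L[ℂ] H) (x : HPow n H) (i : Fin n) :
    kron (1 : Matrix (Fin n) (Fin n) ℂ) P x i = P (x i) := by
  simp [kron_apply, Matrix.one_apply]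

theorem pInner_kron_one (P : H →L[ℂ] H) (x y : HPow n H) :
    pInner (kron (1 : Matrix (Fin n) (Fin n) ℂ) P) x y = ∑ i, pInner P (x i) (y i) := by
  simp [pInner, PiLp.inner_apply, kron_one_apply]

theorem pInner_kron_one_kron (P : H →L[ℂ] H) (A : Matrix (Fin n) (Fin n) ℂ) (B : H →L[ℂ] H)
    (x y : HPow n H) :
    pInner (kron (1 : Matrix (Fin n) (Fin n) ℂ) P) (kron A B x) y =
      ∑ i, ∑ j, A i j * pInner P (B (x j)) (y i) := by
  simp [pInner_kron_one, kron_apply, pInner_sum_left, pInner_smul_left]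

theorem isPositive_kron_one {P : H →L[ℂ] H} (hP : P.IsPositive) :
    (kron (1 : Matrix (Fin n) (Fin n) ℂ) P).IsPositive := by
  refine ⟨fun x y => ?_, fun x => ?_⟩
  · simp only [ContinuousLinearMap.coe_coe, PiLp.inner_apply, kron_one_apply]
    exact Finset.sum_congr rfl fun i _ => hP.inner_left_eq_inner_right _ _
  · simp only [ContinuousLinearMap.reApplyInnerSelf_apply, PiLp.inner_apply, kron_one_apply,
      map_sum]
    exact Finset.sum_nonneg fun i _ => hP.re_inner_nonneg_left _

theorem pNorm_kron_one_sq {P : H →L[ℂ] H} (hP : P.IsPositive) (x : HPow n H) :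
    pNorm (kron (1 : Matrix (Fin n) (Fin n) ℂ) P) x ^ 2 = ∑ i, pNorm P (x i) ^ 2 := by
  simp [pNorm_sq (isPositive_kron_one hP), pNorm_sq hP, pInner_kron_one]

theorem IsPAdjoint.kron {R B B₁ : H →L[ℂ] H} (h : IsPAdjoint R B B₁)
    (A : Matrix (Fin n) (Fin n) ℂ) :
    IsPAdjoint (SemiHilbert.kron (1 : Matrix (Fin n) (Fin n) ℂ) R) (SemiHilbert.kron A B)
      (SemiHilbert.kron A.conjTranspose B₁) := by
  intro x y
  rw [pInner_kron_one_kron, pInner_kron_one, Finset.sum_comm]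
  refine Finset.sum_congr rfl fun j _ => ?_
  rw [kron_apply, pInner_sum_right]
  refine Finset.sum_congr rfl fun i _ => ?_
  rw [pInner_smul_right, h (x j) (y i)]
  simp [Matrix.conjTranspose_apply]

variable [CompleteSpace H]

theorem kron_mem_sqrtAdjointable {P B : H →L[ℂ] H} (hP : P.IsPositive)
    (hB : B ∈ sqrtAdjointable P) (A : Matrix (Fin n) (Fin n) ℂ) :
    kron A B ∈ sqrtAdjointable (kron (1 : Matrix (Fin n) (Fin n) ℂ) P) := by
  obtain ⟨B₁, hB₁⟩ := hB
  refine mem_sqrtAdjointable_of_isPAdjoint (isPositive_kron_one (isPositive_sqrt P))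
    (fun x => ?_) (IsPAdjoint.kron hB₁ A)
  ext i
  simp only [kron_one_apply, sqrt_sqrt_apply hP]

/-- For an off-diagonal `2 × 2` block the quadratic form is bounded by the product of the
seminorms, not only by half the sum of their squares. -/
theorem norm_antidiag_pInner_le {P B : H →L[ℂ] H} (hP : P.IsPositive)
    (hB : B ∈ sqrtAdjointable P) (a b : ℂ) (x y : H) :
    ‖a * pInner P (B y) x + b * pInner P (B x) y‖ ≤
      2 * pNumericalRadius (kron (1 : Matrix (Fin 2) (Fin 2) ℂ) P) (kron !![0, a; b, 0] B) *
        (pNorm P x * pNorm P y) := by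
  set w := pNumericalRadius (kron (1 : Matrix (Fin 2) (Fin 2) ℂ) P) (kron !![0, a; b, 0] B)
    with hw
  set M := ‖a * pInner P (B y) x + b * pInner P (B x) y‖ with hM
  have hw0 : 0 ≤ w := pNumericalRadius_nonneg _ _
  -- The bound by the numerical radius at the vector `(s x, y)`.
  have key (s : ℝ) : |s| * M ≤ w * (s ^ 2 * pNorm P x ^ 2 + pNorm P y ^ 2) := by
    have h := norm_pInner_le (exists_norm_pInner_le (isPositive_kron_one hP)
      (kron_mem_sqrtAdjointable hP hB !![0, a; b, 0])) (WithLp.toLp 2 ![(s : ℂ) • x, y])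
    rw [pNorm_kron_one_sq hP, pInner_kron_one_kron] at h
    simp only [Fin.sum_univ_two, Matrix.of_apply, Matrix.cons_val_zero, Matrix.cons_val_one,
      map_smul, pInner_smul_left, pInner_smul_right, pNorm_smul, Complex.conj_ofReal,
      Complex.norm_real, mul_pow, Real.norm_eq_abs, sq_abs, zero_mul, zero_add,
      add_zero] at h
    rw [hM, ← Real.norm_eq_abs, ← Complex.norm_real, ← norm_mul]
    convert h using 2
    ring
  -- A quadratic polynomial in `s` without sign change has nonpositive discriminant.
  have hd : discrim (w * pNorm P x ^ 2) (-M) (w * pNorm P y ^ 2) ≤ 0 :=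
    discrim_le_zero fun s => by
      nlinarith [key s, mul_le_mul_of_nonneg_right (le_abs_self s) (norm_nonneg _ : 0 ≤ M)]
  have hx := pNorm_nonneg P x
  have hy := pNorm_nonneg P y
  refine abs_le_of_sq_le_sq' ?_ (by positivity) |>.2
  rw [discrim] at hd
  linarith [hd]

end Kronecker

/-! ### The numerical radius of a matrix -/

theorem norm_inner_le_matrixNumericalRadius {n : ℕ} (C : Matrix (Fin n) (Fin n) ℂ)
    {x : EuclideanSpace ℂ (Fin n)} (hx : ‖x‖ = 1) :
    ‖inner ℂ x (Matrix.toEuclideanCLM (𝕜 := ℂ) C x)‖ ≤ matrixNumericalRadius C := by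
  refine le_csSup ⟨‖Matrix.toEuclideanCLM (𝕜 := ℂ) C‖, ?_⟩ ⟨x, hx, rfl⟩
  rintro _ ⟨y, hy, rfl⟩
  calc _ ≤ ‖y‖ * ‖Matrix.toEuclideanCLM (𝕜 := ℂ) C y‖ := norm_inner_le_norm _ _
    _ ≤ ‖y‖ * (‖Matrix.toEuclideanCLM (𝕜 := ℂ) C‖ * ‖y‖) := by
        gcongr; exact ContinuousLinearMap.le_opNorm _ _
    _ = _ := by simp [hy]

theorem matrixNumericalRadius_nonneg {n : ℕ} (C : Matrix (Fin n) (Fin n) ℂ) :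
    0 ≤ matrixNumericalRadius C :=
  Real.sSup_nonneg (by rintro _ ⟨x, -, rfl⟩; exact norm_nonneg _)

theorem sum_mul_le_matrixNumericalRadius {n : ℕ} (c : Fin n → Fin n → ℝ) (ξ : Fin n → ℝ)
    (hξ : ∑ i, ξ i ^ 2 = 1) :
    ∑ i, ∑ j, c i j * (ξ i * ξ j) ≤
      matrixNumericalRadius (Matrix.of fun i j => (c i j : ℂ)) := by
  have hx : ‖(WithLp.toLp 2 fun i => (ξ i : ℂ) : EuclideanSpace ℂ (Fin n))‖ = 1 := by
    simp [EuclideanSpace.norm_eq, hξ]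
  refine le_trans ?_ (norm_inner_le_matrixNumericalRadius _ hx)
  have h : inner ℂ (WithLp.toLp 2 fun i => (ξ i : ℂ) : EuclideanSpace ℂ (Fin n))
      (Matrix.toEuclideanCLM (𝕜 := ℂ) (Matrix.of fun i j => (c i j : ℂ))
        (WithLp.toLp 2 fun i => (ξ i : ℂ))) = ((∑ i, ∑ j, c i j * (ξ i * ξ j) : ℝ) : ℂ) := by
    simp only [PiLp.inner_apply, Matrix.toEuclideanCLM_toLp, Matrix.mulVec, dotProduct,
      Matrix.of_apply, RCLike.inner_apply, Complex.conj_ofReal, Finset.sum_mul]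
    push_cast
    exact Finset.sum_congr rfl fun i _ => Finset.sum_congr rfl fun j _ => by ring
  rw [h, Complex.norm_real]
  exact le_abs_self _

end SemiHilbert

/-! ### The comparison inequality -/

open SemiHilbert in
theorem theorem3p6 {H : Type*} [NormedAddCommGroup H] [InnerProductSpace ℂ H]
    [CompleteSpace H] {n : ℕ} (P : H →L[ℂ] H) (hP : P.IsPositive) (hP0 : P ≠ 0)
    (A : Matrix (Fin n) (Fin n) ℂ) (B : H →L[ℂ] H)
    (hB : B ∈ SemiHilbert.sqrtAdjointable P) :
    SemiHilbert.kron A B ∈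
        SemiHilbert.sqrtAdjointable (SemiHilbert.kron (1 : Matrix (Fin n) (Fin n) ℂ) P) ∧
      (∀ i j : Fin n, i ≠ j →
        SemiHilbert.kron (SemiHilbert.antidiagBlock A i j) B ∈
          SemiHilbert.sqrtAdjointable
            (SemiHilbert.kron (1 : Matrix (Fin 2) (Fin 2) ℂ) P)) ∧
      SemiHilbert.pNumericalRadius (SemiHilbert.kron (1 : Matrix (Fin n) (Fin n) ℂ) P)
          (SemiHilbert.kron A B) ≤
        SemiHilbert.matrixNumericalRadius (SemiHilbert.comparisonMatrix P A B) := by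
  refine ⟨kron_mem_sqrtAdjointable hP hB A,
    fun i j _ => kron_mem_sqrtAdjointable hP hB _, ?_⟩
  refine Real.sSup_le ?_ (matrixNumericalRadius_nonneg _)
  rintro _ ⟨x, hx, rfl⟩
  set c : Fin n → Fin n → ℝ := fun i j =>
    if i = j then ‖A i i‖ * pNumericalRadius P B
    else pNumericalRadius (kron (1 : Matrix (Fin 2) (Fin 2) ℂ) P) (kron (antidiagBlock A i j) B)
    with hc
  have hC : comparisonMatrix P A B = Matrix.of fun i j => (c i j : ℂ) := by
    ext i j
    simp only [comparisonMatrix, Matrix.of_apply, hc]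
    split_ifs <;> rfl
  have hpair (i j : Fin n) : ‖A i j * pInner P (B (x j)) (x i) + A j i * pInner P (B (x i)) (x j)‖
      ≤ 2 * (c i j * (pNorm P (x i) * pNorm P (x j))) := by
    rcases eq_or_ne i j with rfl | hij
    · have h := norm_pInner_le (exists_norm_pInner_le hP hB) (x i)
      rw [← two_mul, norm_mul, norm_mul, Complex.norm_ofNat]
      simp only [hc, if_true]
      nlinarith [mul_le_mul_of_nonneg_left h (norm_nonneg (A i i))]
    · simp only [hc, if_neg hij]
      exact (norm_antidiag_pInner_le hP hB (A i j) (A j i) (x i) (x j)).trans_eq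
        (mul_assoc _ _ _)
  have hsum : ∑ i, pNorm P (x i) ^ 2 = 1 := by
    rw [← pNorm_kron_one_sq hP, hx, one_pow]
  -- Averaging the double sum with its transpose pairs `(i, j)` with `(j, i)`.
  have hsym : 2 * pInner (kron (1 : Matrix (Fin n) (Fin n) ℂ) P) (kron A B x) x =
      ∑ i, ∑ j, (A i j * pInner P (B (x j)) (x i) + A j i * pInner P (B (x i)) (x j)) := by
    simp only [Finset.sum_add_distrib]
    rw [Finset.sum_comm (f := fun i j => A j i * pInner P (B (x i)) (x j)), two_mul,
      pInner_kron_one_kron]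
  rw [hC]
  refine le_trans ?_ (sum_mul_le_matrixNumericalRadius c (fun i => pNorm P (x i)) hsum)
  have h2 : 2 * ‖pInner (kron (1 : Matrix (Fin n) (Fin n) ℂ) P) (kron A B x) x‖ ≤
      2 * ∑ i, ∑ j, c i j * (pNorm P (x i) * pNorm P (x j)) := by
    calc _ = ‖2 * pInner (kron (1 : Matrix (Fin n) (Fin n) ℂ) P) (kron A B x) x‖ := by
          rw [norm_mul, Complex.norm_ofNat]
      _ ≤ ∑ i, ∑ j, 2 * (c i j * (pNorm P (x i) * pNorm P (x j))) := by
          rw [hsym]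
          exact norm_sum_le_of_le _ fun i _ => norm_sum_le_of_le _ fun j _ => hpair i j
      _ = _ := by simp only [Finset.mul_sum]
  linarith
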